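/- **Theorem 1.** Let $\rho_{AB}$ be a two-qubit state, i.e. a positive semidefinite operator of trace $1$ on $\mathbb{C}^2_A\otimes\mathbb{C}^2_B$, and let $\rho_B=\operatorname{tr}_A\rho_{AB}$. Say that $\rho_{AB}$ admits a symmetric extension if there is a three-qubit state $\rho_{ABB'}$ (a positive semidefinite operator of trace $1$ on $\mathbb{C}^2_A\otimes\mathbb{C}^2_B\otimes\mathbb{C}^2_{B'}$) such that $\operatorname{tr}_{B'}\rho_{ABB'}=\rho_{AB}$ and $\operatorname{tr}_{B}\rho_{ABB'}=\rho_{AB}$, where $B'$ is identified with $B$ in the second equation. Then $\rho_{AB}$ admits a symmetric extension if and only if $$\operatorname{tr}(\rho_B^2)\;\ge\;\operatorname{tr}(\rho_{AB}^2)-4\sqrt{\det\rho_{AB}}.$$ -/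

import Mathlib

open scoped ComplexOrder

namespace QuantumState

/-- A density matrix (quantum state) on `ℂ^n`: positive semidefinite with unit trace. -/
def IsState {n : Type*} [Fintype n] (ρ : Matrix n n ℂ) : Prop :=
  ρ.PosSemidef ∧ ρ.trace = 1

/-- The marginal on the second factor of a bipartite operator: `ρ_B = tr_A ρ_AB`. -/
def marginalB {A B : Type*} [Fintype A] (ρ : Matrix (A × B) (A × B) ℂ) : Matrix B B ℂ :=
  fun b b' => ∑ a, ρ (a, b) (a, b')

/-- The marginal on `A` and the first copy of `B` of an operator on `A ⊗ B ⊗ B'`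
(partial trace over `B'`). -/
def marginalAB {A B : Type*} [Fintype B] (τ : Matrix (A × B × B) (A × B × B) ℂ) :
    Matrix (A × B) (A × B) ℂ :=
  fun i j => ∑ c, τ (i.1, i.2, c) (j.1, j.2, c)

/-- The marginal on `A` and the second copy `B'` of an operator on `A ⊗ B ⊗ B'`
(partial trace over `B`). -/
def marginalAB' {A B : Type*} [Fintype B] (τ : Matrix (A × B × B) (A × B × B) ℂ) :
    Matrix (A × B) (A × B) ℂ :=
  fun i j => ∑ b, τ (i.1, b, i.2) (j.1, b, j.2)

/-- `ρ_AB` admits a symmetric extension: there is a state on `A ⊗ B ⊗ B'`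
(with `B'` a copy of `B`) whose `AB` and `AB'` marginals are both `ρ_AB`. -/
def HasSymmetricExtension {A B : Type*} [Fintype A] [Fintype B]
    (ρ : Matrix (A × B) (A × B) ℂ) : Prop :=
  ∃ τ : Matrix (A × B × B) (A × B × B) ℂ, IsState τ ∧ marginalAB τ = ρ ∧ marginalAB' τ = ρ

end QuantumState

namespace QuantumState

open scoped Kronecker Matrix

/-! Write Θ = 1 ⊗ ρ_B - ρ and Q = tr(ρΘ) = tr ρ_B² - tr ρ². Two polynomial identities carry the
proof: tr_B(ρΘ) = (Q/2)1 and ΘρΘ + adj ρ - (Q/2)Θ = C ⊗ 1 (`sum_mul_reduction`,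
`reduction_identity`). If ρ > 0, Q = -4q and 0 ≤ q ≤ √det ρ, then H = Θ + qρ⁻¹ satisfies tr_B(ρH) =
0 and HρH + (det ρ - q²)ρ⁻¹ = C ⊗ 1 with C > 0.

Sufficiency: solving for ρ gives ρ = (ρH)(C⁻¹ ⊗ 1)(ρH)* + (det ρ - q²)(C⁻¹ ⊗ 1), and both summands
extend. If Q > 0, ρ is a combination of operators that are products or have Q = 0; singular states
follow by a limit.

Necessity: at the boundary q = √det σ, H is positive on product vectors and H⁻¹ has zero partial
trace over B, which forces tr(Hρ) ≥ 0 for every extendible ρ (`SymmExtendible.trace_mul_nonneg`). A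
state violating the inequality reaches the boundary at some σ = ρ + t1 with t > 0; there tr(Hσ) = 0,
so tr(Hρ) = -t tr H < 0. -/

/-! ### Polynomial identities for the reduction map -/

/-- The reduction map `ρ ↦ 1 ⊗ ρ_B - ρ`. -/
def reduction (ρ : Matrix (Fin 2 × Fin 2) (Fin 2 × Fin 2) ℂ) :
    Matrix (Fin 2 × Fin 2) (Fin 2 × Fin 2) ℂ :=
  1 ⊗ₖ marginalB ρ - ρ

/-- The quadratic form `ρ ↦ tr (ρ (1 ⊗ ρ_B - ρ)) = tr ρ_B² - tr ρ²`. -/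
def purityGap (ρ : Matrix (Fin 2 × Fin 2) (Fin 2 × Fin 2) ℂ) : ℂ :=
  (ρ * reduction ρ).trace

theorem purityGap_eq (ρ : Matrix (Fin 2 × Fin 2) (Fin 2 × Fin 2) ℂ) :
    purityGap ρ = (marginalB ρ ^ 2).trace - (ρ ^ 2).trace := by
  simp only [purityGap, reduction, Matrix.mul_sub, Matrix.trace_sub, pow_two]
  congr 1
  simp [Matrix.trace, Matrix.mul_apply, Fintype.sum_prod_type, marginalB, Matrix.one_apply]
  ring

/-- In 2 × 2 blocks R_{aa'} over A, Θ has rows (R₁₁, -R₀₁) and (-R₁₀, R₀₀). The off-diagonal blocks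
of ρΘ are commutators, hence traceless, and the two diagonal blocks have equal trace by cyclicity.
-/
theorem sum_mul_reduction (ρ : Matrix (Fin 2 × Fin 2) (Fin 2 × Fin 2) ℂ) (a a' : Fin 2) :
    ∑ b, (ρ * reduction ρ) (a, b) (a', b) = if a = a' then purityGap ρ / 2 else 0 := by
  fin_cases a <;> fin_cases a' <;>
  simp [purityGap, reduction, Matrix.trace, Matrix.mul_apply, Fintype.sum_prod_type, marginalB,
    Matrix.one_apply] <;> ring

/-- Cofactors over `Fin 4` express the adjugate through 3 × 3 minors, so that the identity below can
be checked entry by entry. -/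
theorem adjugate_prod_apply (ρ : Matrix (Fin 2 × Fin 2) (Fin 2 × Fin 2) ℂ) (i j : Fin 2 × Fin 2) :
    ρ.adjugate i j = (-1) ^ (finProdFinEquiv j + finProdFinEquiv i : ℕ) *
      ((ρ.submatrix (finProdFinEquiv (m := 2) (n := 2)).symm finProdFinEquiv.symm).submatrix
        (finProdFinEquiv j).succAbove (finProdFinEquiv i).succAbove).det := by
  have h := Matrix.adjugate_submatrix_equiv_self (finProdFinEquiv (m := 2) (n := 2)).symm ρ
  have h2 := congrFun (congrFun h (finProdFinEquiv i)) (finProdFinEquiv j)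
  simp only [Matrix.submatrix_apply, Equiv.symm_apply_apply] at h2
  rw [← h2]
  exact Matrix.adjugate_fin_succ_eq_det_submatrix (n := 3) _ _ _

theorem finProdFinEquiv_symm_two_two :
    (finProdFinEquiv (m := 2) (n := 2)).symm 0 = (0, 0) ∧
    (finProdFinEquiv (m := 2) (n := 2)).symm 1 = (0, 1) ∧
    (finProdFinEquiv (m := 2) (n := 2)).symm 2 = (1, 0) ∧
    (finProdFinEquiv (m := 2) (n := 2)).symm 3 = (1, 1) := by decide

theorem finProdFinEquiv_two_two :
    finProdFinEquiv ((0, 0) : Fin 2 × Fin 2) = (0 : Fin 4) ∧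
    finProdFinEquiv ((0, 1) : Fin 2 × Fin 2) = (1 : Fin 4) ∧
    finProdFinEquiv ((1, 0) : Fin 2 × Fin 2) = (2 : Fin 4) ∧
    finProdFinEquiv ((1, 1) : Fin 2 × Fin 2) = (3 : Fin 4) := by decide

/-- The matrix `C` on `A` with `ΘρΘ + adj ρ - (Q / 2) Θ = C ⊗ 1`. -/
noncomputable def reductionCore (ρ : Matrix (Fin 2 × Fin 2) (Fin 2 × Fin 2) ℂ) : Matrix (Fin 2) (Fin 2) ℂ :=
  fun a a' => (reduction ρ * ρ * reduction ρ + ρ.adjugate - (purityGap ρ / 2) • reduction ρ)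
    (a, 0) (a', 0)

-- Every entry is a cubic polynomial identity in the entries of ρ; no hermiticity enters.
set_option maxHeartbeats 4000000 in
theorem reduction_identity (ρ : Matrix (Fin 2 × Fin 2) (Fin 2 × Fin 2) ℂ) :
    reduction ρ * ρ * reduction ρ + ρ.adjugate - (purityGap ρ / 2) • reduction ρ =
      reductionCore ρ ⊗ₖ 1 := by
  obtain ⟨s0, s1, s2, s3⟩ := finProdFinEquiv_symm_two_two
  obtain ⟨e0, e1, e2, e3⟩ := finProdFinEquiv_two_two
  ext ⟨a, b⟩ ⟨a', b'⟩
  fin_cases a <;> fin_cases b <;> fin_cases a' <;> fin_cases b' <;>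
  simp [reductionCore, purityGap, reduction, Matrix.trace, Matrix.mul_apply,
    Fintype.sum_prod_type, marginalB, Matrix.one_apply, adjugate_prod_apply, e0, e1, e2, e3,
    Matrix.det_fin_three, Fin.succAbove, s0, s1, s2, s3] <;> ring

/-! ### The convex cone of extendible operators and its basic members -/

/-- The unnormalised form of `HasSymmetricExtension`. -/
def SymmExtendible {A B : Type*} [Fintype A] [Fintype B] (ρ : Matrix (A × B) (A × B) ℂ) : Prop :=
  ∃ τ : Matrix (A × B × B) (A × B × B) ℂ, τ.PosSemidef ∧ marginalAB τ = ρ ∧ marginalAB' τ = ρ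

section Cone

variable {A B : Type*} [Fintype A] [Fintype B]

theorem trace_marginalAB (τ : Matrix (A × B × B) (A × B × B) ℂ) :
    (marginalAB τ).trace = τ.trace := by
  simp [Matrix.trace, marginalAB, Fintype.sum_prod_type]

theorem SymmExtendible.hasSymmetricExtension {ρ : Matrix (A × B) (A × B) ℂ}
    (h : SymmExtendible ρ) (hρ : ρ.trace = 1) : HasSymmetricExtension ρ := by
  obtain ⟨τ, hτ, h1, h2⟩ := h
  exact ⟨τ, ⟨hτ, by rw [← trace_marginalAB, h1, hρ]⟩, h1, h2⟩

theorem SymmExtendible.add {ρ σ : Matrix (A × B) (A × B) ℂ}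
    (hρ : SymmExtendible ρ) (hσ : SymmExtendible σ) : SymmExtendible (ρ + σ) := by
  obtain ⟨τ, hτ, h1, h2⟩ := hρ
  obtain ⟨υ, hυ, h3, h4⟩ := hσ
  refine ⟨τ + υ, hτ.add hυ, ?_, ?_⟩
  · rw [← h1, ← h3]; ext i j; simp [marginalAB, Finset.sum_add_distrib]
  · rw [← h2, ← h4]; ext i j; simp [marginalAB', Finset.sum_add_distrib]

theorem SymmExtendible.smul {ρ : Matrix (A × B) (A × B) ℂ} (hρ : SymmExtendible ρ)
    {r : ℝ} (hr : 0 ≤ r) : SymmExtendible ((r : ℂ) • ρ) := by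
  obtain ⟨τ, hτ, h1, h2⟩ := hρ
  refine ⟨(r : ℂ) • τ, hτ.smul (by exact_mod_cast hr), ?_, ?_⟩
  · rw [← h1]; ext i j; simp [marginalAB, Finset.mul_sum]
  · rw [← h2]; ext i j; simp [marginalAB', Finset.mul_sum]

theorem SymmExtendible.zero : SymmExtendible (0 : Matrix (A × B) (A × B) ℂ) :=
  ⟨0, .zero, by ext; simp [marginalAB], by ext; simp [marginalAB']⟩

theorem SymmExtendible.sum {ι : Type*} (s : Finset ι) {ρ : ι → Matrix (A × B) (A × B) ℂ}
    (h : ∀ i ∈ s, SymmExtendible (ρ i)) : SymmExtendible (∑ i ∈ s, ρ i) := by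
  classical
  induction s using Finset.induction_on with
  | empty => simpa using SymmExtendible.zero
  | insert i s hi ih =>
    rw [Finset.sum_insert hi]
    exact (h i (Finset.mem_insert_self i s)).add
      (ih fun j hj => h j (Finset.mem_insert_of_mem hj))

end Cone

/-- Let V apply G to A and one half of an unnormalised singlet on BB'. Tracing out B' from V N V*
gives G(N ⊗ 1)G*. The part of V antisymmetric in BB' is tr_B G, so the hypothesis makes V symmetric.
-/
theorem symmExtendible_conj {N : Matrix (Fin 2) (Fin 2) ℂ} (hN : N.PosSemidef)
    {G : Matrix (Fin 2 × Fin 2) (Fin 2 × Fin 2) ℂ}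
    (hG : ∀ a a', G (a, 0) (a', 0) + G (a, 1) (a', 1) = 0) :
    SymmExtendible (G * (N ⊗ₖ 1) * Gᴴ) := by
  let V : Matrix (Fin 2 × Fin 2 × Fin 2) (Fin 2) ℂ := fun i k =>
    if i.2.2 = 1 then G (i.1, i.2.1) (k, 0) else - G (i.1, i.2.1) (k, 1)
  have hV : ∀ a b c k, V (a, b, c) k = V (a, c, b) k := by
    intro a b c k
    have := hG a k
    fin_cases b <;> fin_cases c <;> simp [V]
    · linear_combination this
    · linear_combination -this
  have h1 : marginalAB (V * N * Vᴴ) = G * (N ⊗ₖ 1) * Gᴴ := by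
    ext ⟨a, b⟩ ⟨a', b'⟩
    simp only [marginalAB, Matrix.mul_apply, Fintype.sum_prod_type, Matrix.conjTranspose_apply,
      Fin.sum_univ_two, Matrix.kroneckerMap_apply, Matrix.one_apply]
    simp [V]
    ring
  refine ⟨V * N * Vᴴ, hN.mul_mul_conjTranspose_same V, h1, ?_⟩
  rw [← h1]
  ext ⟨a, b⟩ ⟨a', b'⟩
  simp only [marginalAB, marginalAB', Matrix.mul_apply, Matrix.conjTranspose_apply]
  simp only [hV _ _ b, hV _ _ b']

theorem symmExtendible_kronecker_one {N : Matrix (Fin 2) (Fin 2) ℂ} (hN : N.PosSemidef) :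
    SymmExtendible (N ⊗ₖ (1 : Matrix (Fin 2) (Fin 2) ℂ)) := by
  have h : ((((1 / 2 : ℝ) : ℂ) • N) ⊗ₖ (1 : Matrix (Fin 2 × Fin 2) (Fin 2 × Fin 2) ℂ)).PosSemidef :=
    (hN.smul (by simp)).kronecker .one
  refine ⟨_, h, ?_, ?_⟩
  · ext ⟨a, b⟩ ⟨a', b'⟩
    fin_cases b <;> fin_cases b' <;> simp [marginalAB]
  · ext ⟨a, b⟩ ⟨a', b'⟩
    fin_cases b <;> fin_cases b' <;> simp [marginalAB']

/-- The vector v ⊗ w ⊗ w extends ‖w‖² times the operator; the factor is then divided out, unless w =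
0. -/
theorem symmExtendible_product (v w : Fin 2 → ℂ) :
    SymmExtendible (Matrix.vecMulVec (fun i : Fin 2 × Fin 2 => v i.1 * w i.2)
      (star fun i : Fin 2 × Fin 2 => v i.1 * w i.2)) := by
  have key : SymmExtendible ((((‖w 0‖ ^ 2 + ‖w 1‖ ^ 2 : ℝ) : ℂ)) •
      Matrix.vecMulVec (fun i : Fin 2 × Fin 2 => v i.1 * w i.2)
      (star fun i : Fin 2 × Fin 2 => v i.1 * w i.2)) := by
    refine ⟨_, Matrix.posSemidef_vecMulVec_self_star
      (fun i : Fin 2 × Fin 2 × Fin 2 => v i.1 * w i.2.1 * w i.2.2), ?_, ?_⟩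
    · ext i j
      simp [marginalAB, Matrix.vecMulVec_apply, ← Complex.mul_conj']
      ring
    · ext i j
      simp [marginalAB', Matrix.vecMulVec_apply, ← Complex.mul_conj']
      ring
  set r := ‖w 0‖ ^ 2 + ‖w 1‖ ^ 2
  have hr0 : 0 ≤ r := by positivity
  by_cases h : r = 0
  · have h0 : w 0 = 0 := by
      have : ‖w 0‖ ^ 2 = 0 := by nlinarith [sq_nonneg ‖w 0‖, sq_nonneg ‖w 1‖]
      simpa using this
    have h1 : w 1 = 0 := by
      have : ‖w 1‖ ^ 2 = 0 := by nlinarith [sq_nonneg ‖w 0‖, sq_nonneg ‖w 1‖]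
      simpa using this
    have hz : Matrix.vecMulVec (fun i : Fin 2 × Fin 2 => v i.1 * w i.2)
        (star fun i : Fin 2 × Fin 2 => v i.1 * w i.2) = 0 := by
      ext ⟨a, b⟩ j
      fin_cases b <;> simp [Matrix.vecMulVec_apply, h0, h1]
    rw [hz]
    exact .zero
  · have := key.smul (inv_nonneg.2 hr0)
    rwa [smul_smul, ← Complex.ofReal_mul, inv_mul_cancel₀ h, Complex.ofReal_one, one_smul] at this

/-! ### The witness: block positivity and completed square -/

/-- The Hermitian witness `Θ(ρ) + q ρ⁻¹`. -/
noncomputable def witness (ρ : Matrix (Fin 2 × Fin 2) (Fin 2 × Fin 2) ℂ) (q : ℝ) :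
    Matrix (Fin 2 × Fin 2) (Fin 2 × Fin 2) ℂ :=
  reduction ρ + (q : ℂ) • ρ⁻¹

theorem marginalB_isHermitian {ρ : Matrix (Fin 2 × Fin 2) (Fin 2 × Fin 2) ℂ}
    (hρ : ρ.IsHermitian) : (marginalB ρ).IsHermitian := by
  ext b b'
  simp only [Matrix.conjTranspose_apply, marginalB, star_sum]
  exact Finset.sum_congr rfl fun a _ => hρ.apply _ _

theorem reduction_isHermitian {ρ : Matrix (Fin 2 × Fin 2) (Fin 2 × Fin 2) ℂ}
    (hρ : ρ.IsHermitian) : (reduction ρ).IsHermitian := by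
  refine Matrix.IsHermitian.sub ?_ hρ
  rw [Matrix.IsHermitian, Matrix.conjTranspose_kronecker, Matrix.conjTranspose_one,
    marginalB_isHermitian hρ]

theorem purityGap_im {ρ : Matrix (Fin 2 × Fin 2) (Fin 2 × Fin 2) ℂ}
    (hρ : ρ.IsHermitian) : (purityGap ρ).im = 0 := by
  rw [← Complex.conj_eq_iff_im, starRingEnd_apply, purityGap, ← Matrix.trace_conjTranspose,
    Matrix.conjTranspose_mul, hρ, reduction_isHermitian hρ, Matrix.trace_mul_comm]

theorem witness_isHermitian {ρ : Matrix (Fin 2 × Fin 2) (Fin 2 × Fin 2) ℂ}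
    (hρ : ρ.IsHermitian) (q : ℝ) : (witness ρ q).IsHermitian := by
  refine (reduction_isHermitian hρ).add ?_
  rw [Matrix.IsHermitian, Matrix.conjTranspose_smul, hρ.inv]
  simp

/-- On A, the map X ↦ (tr X)1 - X exchanges v with the orthogonal vector of the same norm. -/
theorem reduction_product_form (ρ : Matrix (Fin 2 × Fin 2) (Fin 2 × Fin 2) ℂ) (v w : Fin 2 → ℂ) :
    star (fun i : Fin 2 × Fin 2 => v i.1 * w i.2) ⬝ᵥ
        (reduction ρ *ᵥ fun i => v i.1 * w i.2) =
      star (fun i : Fin 2 × Fin 2 => ![-star (v 1), star (v 0)] i.1 * w i.2) ⬝ᵥ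
        (ρ *ᵥ fun i => ![-star (v 1), star (v 0)] i.1 * w i.2) := by
  simp [dotProduct, Matrix.mulVec, Fintype.sum_prod_type, reduction, marginalB, Matrix.one_apply]
  ring

theorem product_ne_zero {v w : Fin 2 → ℂ} (hv : v ≠ 0) (hw : w ≠ 0) :
    (fun i : Fin 2 × Fin 2 => v i.1 * w i.2) ≠ 0 := by
  obtain ⟨a, ha⟩ := Function.ne_iff.1 hv
  obtain ⟨b, hb⟩ := Function.ne_iff.1 hw
  exact fun h => mul_ne_zero ha hb (congrFun h (a, b))

theorem witness_product_pos {ρ : Matrix (Fin 2 × Fin 2) (Fin 2 × Fin 2) ℂ} (hρ : ρ.PosDef)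
    {q : ℝ} (hq : 0 ≤ q) {v w : Fin 2 → ℂ} (hv : v ≠ 0) (hw : w ≠ 0) :
    0 < star (fun i : Fin 2 × Fin 2 => v i.1 * w i.2) ⬝ᵥ
      (witness ρ q *ᵥ fun i => v i.1 * w i.2) := by
  rw [witness, Matrix.add_mulVec, dotProduct_add, reduction_product_form]
  refine add_pos_of_pos_of_nonneg (hρ.dotProduct_mulVec_pos (product_ne_zero ?_ hw)) ?_
  · intro h
    apply hv
    ext a
    have h0 := congrFun h 0
    have h1 := congrFun h 1
    fin_cases a <;> simp_all
  · rw [Matrix.smul_mulVec, dotProduct_smul]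
    exact smul_nonneg (by exact_mod_cast hq) (hρ.inv.posSemidef.dotProduct_mulVec_nonneg _)

theorem sum_mul_witness {ρ : Matrix (Fin 2 × Fin 2) (Fin 2 × Fin 2) ℂ} (hρ : ρ.PosDef) {q : ℝ}
    (hq : purityGap ρ = -4 * q) (a a' : Fin 2) :
    (ρ * witness ρ q) (a, 0) (a', 0) + (ρ * witness ρ q) (a, 1) (a', 1) = 0 := by
  have hu : IsUnit ρ.det := (Matrix.isUnit_iff_isUnit_det _).1 hρ.isUnit
  have h := sum_mul_reduction ρ a a'
  rw [Fin.sum_univ_two] at h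
  rw [witness, Matrix.mul_add, Matrix.mul_smul, Matrix.mul_nonsing_inv _ hu]
  simp only [Matrix.add_apply, Matrix.smul_apply, Matrix.one_apply, smul_eq_mul, Prod.mk.injEq,
    and_true]
  split_ifs at h ⊢ with haa
  · linear_combination h + hq / 2
  · linear_combination h

/-- With -Q/2 = 2q the term in Θ of `reduction_identity` completes the square HρH, at the cost of
q²ρ⁻¹. -/
theorem witness_identity {ρ : Matrix (Fin 2 × Fin 2) (Fin 2 × Fin 2) ℂ} (hρ : ρ.PosDef) {q : ℝ}
    (hq : purityGap ρ = -4 * q) :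
    witness ρ q * ρ * witness ρ q + (ρ.det - (q : ℂ) ^ 2) • ρ⁻¹ = reductionCore ρ ⊗ₖ 1 := by
  have hu : IsUnit ρ.det := (Matrix.isUnit_iff_isUnit_det _).1 hρ.isUnit
  have hadj : ρ.adjugate = ρ.det • ρ⁻¹ := by
    rw [Matrix.inv_def, smul_smul, Ring.mul_inverse_cancel _ hu, one_smul]
  rw [← reduction_identity, hadj, hq, witness]
  simp only [Matrix.add_mul, Matrix.mul_add, Matrix.smul_mul, Matrix.mul_smul,
    Matrix.nonsing_inv_mul _ hu, Matrix.one_mul, Matrix.mul_assoc, Matrix.mul_nonsing_inv _ hu,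
    Matrix.mul_one]
  module

/-- Test C ⊗ 1 on p = v ⊗ e₀. Block positivity gives ⟨p, Hp⟩ > 0, hence Hp ≠ 0, and the term HρH is
strictly positive at p. -/
theorem reductionCore_posDef {ρ : Matrix (Fin 2 × Fin 2) (Fin 2 × Fin 2) ℂ} (hρ : ρ.PosDef)
    {q : ℝ} (hq : purityGap ρ = -4 * q) (hq0 : 0 ≤ q) (hd : (q : ℂ) ^ 2 ≤ ρ.det) :
    (reductionCore ρ).PosDef := by
  have hid := witness_identity hρ hq
  have hH := witness_isHermitian hρ.isHermitian q
  set H := witness ρ q with hHdef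
  have hM : (reductionCore ρ ⊗ₖ (1 : Matrix (Fin 2) (Fin 2) ℂ)).PosSemidef := by
    rw [← hid]
    refine .add ?_ (hρ.inv.posSemidef.smul (sub_nonneg.2 hd))
    have := hρ.posSemidef.mul_mul_conjTranspose_same H
    rwa [hH] at this
  refine .of_dotProduct_mulVec_pos ?_ fun v hv => ?_
  · ext a a'
    simpa using hM.isHermitian.apply (a, 0) (a', 0)
  · have hw : (![1, 0] : Fin 2 → ℂ) ≠ 0 := fun h => by simpa using congrFun h 0
    have hp := witness_product_pos hρ hq0 hv hw
    set p : Fin 2 × Fin 2 → ℂ := fun i => v i.1 * (![1, 0] : Fin 2 → ℂ) i.2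
    have hHp : H *ᵥ p ≠ 0 := by
      intro h
      rw [← hHdef, h] at hp
      simp at hp
    have e : star v ⬝ᵥ (reductionCore ρ *ᵥ v) =
        star p ⬝ᵥ ((reductionCore ρ ⊗ₖ (1 : Matrix (Fin 2) (Fin 2) ℂ)) *ᵥ p) := by
      simp [dotProduct, Matrix.mulVec, Fintype.sum_prod_type, p]
    rw [e, ← hid, Matrix.add_mulVec, dotProduct_add]
    refine add_pos_of_pos_of_nonneg ?_ ?_
    · have := hρ.dotProduct_mulVec_pos hHp
      rwa [Matrix.star_mulVec, hH, ← Matrix.dotProduct_mulVec, Matrix.mulVec_mulVec,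
        Matrix.mulVec_mulVec] at this
    · rw [Matrix.smul_mulVec, dotProduct_smul]
      exact smul_nonneg (sub_nonneg.2 hd) (hρ.inv.posSemidef.dotProduct_mulVec_nonneg _)

/-! ### Sufficiency for positive definite operators -/

theorem kronecker_one_mul_inv {C : Matrix (Fin 2) (Fin 2) ℂ} (hC : IsUnit C) :
    (C ⊗ₖ (1 : Matrix (Fin 2) (Fin 2) ℂ)) * (C⁻¹ ⊗ₖ 1) = 1 := by
  rw [← Matrix.mul_kronecker_mul, Matrix.mul_one,
    Matrix.mul_nonsing_inv _ ((Matrix.isUnit_iff_isUnit_det _).1 hC), Matrix.one_kronecker_one]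

/-- A positive definite operator with `-4 √det ρ ≤ tr ρ_B² - tr ρ² ≤ 0` has a symmetric
extension. -/
theorem symmExtendible_of_purityGap_nonpos {ρ : Matrix (Fin 2 × Fin 2) (Fin 2 × Fin 2) ℂ}
    (hρ : ρ.PosDef) {q : ℝ} (hq : purityGap ρ = -4 * q) (hq0 : 0 ≤ q)
    (hd : (q : ℂ) ^ 2 ≤ ρ.det) : SymmExtendible ρ := by
  have hu : IsUnit ρ.det := (Matrix.isUnit_iff_isUnit_det _).1 hρ.isUnit
  have hC := reductionCore_posDef hρ hq hq0 hd
  have hid := witness_identity hρ hq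
  have hH := witness_isHermitian hρ.isHermitian q
  have htr := sum_mul_witness hρ hq
  set H := witness ρ q
  set C := reductionCore ρ
  set ε : ℂ := ρ.det - (q : ℂ) ^ 2 with hε
  have hεn : 0 ≤ ε := sub_nonneg.2 hd
  have hε' : ε = (ε.re : ℂ) := Complex.eq_re_of_ofReal_le (r := 0) (by simpa using hεn)
  have hε0 : 0 ≤ ε.re := (Complex.le_def.1 hεn).1
  have hMN := kronecker_one_mul_inv hC.isUnit
  have hNM := mul_eq_one_comm.1 hMN
  set M := C ⊗ₖ (1 : Matrix (Fin 2) (Fin 2) ℂ)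
  set N := C⁻¹ ⊗ₖ (1 : Matrix (Fin 2) (Fin 2) ℂ)
  -- Both sides equal HρHρH + εH.
  have hcomm : M * (ρ * H) = (H * ρ) * M := by
    rw [← hid]
    simp only [Matrix.add_mul, Matrix.mul_add, Matrix.smul_mul, Matrix.mul_smul, Matrix.mul_assoc,
      Matrix.mul_nonsing_inv _ hu, Matrix.nonsing_inv_mul_cancel_left _ _ hu, Matrix.mul_one]
  have hcomm' : (ρ * H) * N = N * (H * ρ) := by
    calc (ρ * H) * N = N * (M * (ρ * H)) * N := by rw [← Matrix.mul_assoc N, hNM, Matrix.one_mul]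
      _ = N * (H * ρ) * (M * N) := by rw [hcomm]; simp only [Matrix.mul_assoc]
      _ = _ := by rw [hMN, Matrix.mul_one]
  -- Expand ρ = N M ρ = N(HρHρ + ε), then move one factor Hρ across N.
  have hdecomp : ρ = (ρ * H) * N * (ρ * H)ᴴ + ε • N := by
    have : (ρ * H)ᴴ = H * ρ := by rw [Matrix.conjTranspose_mul, hH, hρ.isHermitian]
    rw [this, hcomm']
    calc ρ = N * M * ρ := by rw [hNM, Matrix.one_mul]
      _ = N * (H * ρ) * (H * ρ) + ε • N := by
        rw [← hid]
        simp only [Matrix.add_mul, Matrix.mul_add, Matrix.smul_mul, Matrix.mul_smul,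
          Matrix.mul_assoc, Matrix.nonsing_inv_mul _ hu, Matrix.mul_one]
  rw [hdecomp, hε']
  exact (symmExtendible_conj hC.inv.posSemidef htr).add
    ((symmExtendible_kronecker_one hC.inv.posSemidef).smul hε0)

theorem isHermitian_eq_sum {n : Type*} [Fintype n] [DecidableEq n] {M : Matrix n n ℂ}
    (hM : M.IsHermitian) :
    M = ∑ k, (hM.eigenvalues k : ℂ) •
      Matrix.vecMulVec (fun i => (hM.eigenvectorUnitary : Matrix n n ℂ) i k)
        (star fun i => (hM.eigenvectorUnitary : Matrix n n ℂ) i k) := by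
  conv_lhs => rw [hM.spectral_theorem, Unitary.conjStarAlgAut_apply]
  ext i j
  rw [Matrix.mul_apply]
  simp only [Matrix.mul_diagonal, Matrix.sum_apply, Matrix.smul_apply,
    Matrix.vecMulVec_apply, Matrix.star_apply, Pi.star_apply, smul_eq_mul, Function.comp_apply]
  refine Finset.sum_congr rfl fun k _ => ?_
  simp
  ring

theorem exists_product_of_det_eq_zero {w : Fin 2 × Fin 2 → ℂ}
    (h : w (0, 0) * w (1, 1) = w (0, 1) * w (1, 0)) :
    ∃ u v : Fin 2 → ℂ, w = fun i => u i.1 * v i.2 := by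
  by_cases h0 : ∃ b, w (0, b) ≠ 0
  · obtain ⟨b, hb⟩ := h0
    refine ⟨![1, w (1, b) / w (0, b)], fun b' => w (0, b'), ?_⟩
    ext ⟨a, b'⟩
    fin_cases a
    · simp
    · fin_cases b <;> fin_cases b' <;> simp at hb ⊢ <;> field_simp
      · linear_combination h
      · linear_combination -h
  · push Not at h0
    refine ⟨![0, 1], fun b' => w (1, b'), ?_⟩
    ext ⟨a, b'⟩
    fin_cases a
    · simpa using h0 b'
    · simp

theorem reduction_add (ρ σ : Matrix (Fin 2 × Fin 2) (Fin 2 × Fin 2) ℂ) :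
    reduction (ρ + σ) = reduction ρ + reduction σ := by
  have : marginalB (ρ + σ) = marginalB ρ + marginalB σ := by
    ext; simp [marginalB, Finset.sum_add_distrib]
  rw [reduction, this, Matrix.kronecker_add, reduction, reduction]
  abel

theorem reduction_smul (c : ℂ) (ρ : Matrix (Fin 2 × Fin 2) (Fin 2 × Fin 2) ℂ) :
    reduction (c • ρ) = c • reduction ρ := by
  have : marginalB (c • ρ) = c • marginalB ρ := by
    ext; simp [marginalB, mul_add]
  rw [reduction, this, Matrix.kronecker_smul, reduction, smul_sub]

theorem purityGap_add_smul (ρ σ : Matrix (Fin 2 × Fin 2) (Fin 2 × Fin 2) ℂ) (s : ℂ) :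
    purityGap (ρ + s • σ) = purityGap ρ +
      s * ((ρ * reduction σ).trace + (σ * reduction ρ).trace) + s ^ 2 * purityGap σ := by
  simp only [purityGap, reduction_add, reduction_smul, Matrix.add_mul, Matrix.mul_add,
    Matrix.smul_mul, Matrix.mul_smul, Matrix.trace_add, Matrix.trace_smul, smul_eq_mul]
  ring

/-- The gap of a pure state is negative unless the vector is a product. -/
theorem purityGap_vecMulVec (w : Fin 2 × Fin 2 → ℂ) :
    purityGap (Matrix.vecMulVec w (star w)) =
      ((-2 * Complex.normSq (w (0, 0) * w (1, 1) - w (0, 1) * w (1, 0)) : ℝ) : ℂ) := by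
  push_cast
  rw [← Complex.mul_conj]
  simp [purityGap, reduction, Matrix.trace, Matrix.mul_apply, Fintype.sum_prod_type, marginalB,
    Matrix.one_apply, Matrix.vecMulVec_apply]
  ring

theorem exists_pos_root {a b c : ℝ} (ha : 0 < a) (hc : 0 < c) :
    ∃ s, 0 < s ∧ a + s * b + s ^ 2 * (-c) = 0 := by
  have hs : Real.sqrt (b ^ 2 + 4 * a * c) ^ 2 = b ^ 2 + 4 * a * c :=
    Real.sq_sqrt (by positivity)
  have hlt : |b| < Real.sqrt (b ^ 2 + 4 * a * c) := by
    rw [← Real.sqrt_sq_eq_abs]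
    exact Real.sqrt_lt_sqrt (sq_nonneg b) (by nlinarith [mul_pos ha hc])
  refine ⟨(b + Real.sqrt (b ^ 2 + 4 * a * c)) / (2 * c), ?_, ?_⟩
  · have := neg_abs_le b
    exact div_pos (by linarith) (by linarith)
  · generalize Real.sqrt (b ^ 2 + 4 * a * c) = r at hs
    field_simp
    linear_combination -hs

/-- Along ρ + s ww* with w entangled, the gap is a concave quadratic in s, positive at s = 0; at its
positive root the case q = 0 applies. -/
theorem exists_smul_add_pure {ρ : Matrix (Fin 2 × Fin 2) (Fin 2 × Fin 2) ℂ} (hρ : ρ.PosDef)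
    (hq : 0 < (purityGap ρ).re) (w : Fin 2 × Fin 2 → ℂ) :
    ∃ α : ℝ, 0 ≤ α ∧ SymmExtendible ((α : ℂ) • ρ + Matrix.vecMulVec w (star w)) := by
  by_cases hw : w (0, 0) * w (1, 1) = w (0, 1) * w (1, 0)
  · obtain ⟨u, v, rfl⟩ := exists_product_of_det_eq_zero hw
    exact ⟨0, le_rfl, by simpa using symmExtendible_product u v⟩
  · have hpsd := Matrix.posSemidef_vecMulVec_self_star w
    have hgap := purityGap_vecMulVec w
    have hc : 0 < 2 * Complex.normSq (w (0, 0) * w (1, 1) - w (0, 1) * w (1, 0)) :=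
      mul_pos two_pos (Complex.normSq_pos.2 (sub_ne_zero.2 hw))
    set σ := Matrix.vecMulVec w (star w)
    set c := 2 * Complex.normSq (w (0, 0) * w (1, 1) - w (0, 1) * w (1, 0)) with hcdef
    obtain ⟨s, hs, hroot⟩ := exists_pos_root
      (b := ((ρ * reduction σ).trace + (σ * reduction ρ).trace).re) hq hc
    have hpd : (ρ + (s : ℂ) • σ).PosDef :=
      hρ.add_posSemidef (hpsd.smul (by exact_mod_cast hs.le))
    have h0 : purityGap (ρ + (s : ℂ) • σ) = -4 * ((0 : ℝ) : ℂ) := by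
      rw [Complex.ofReal_zero, mul_zero]
      refine Complex.ext ?_ (purityGap_im hpd.isHermitian)
      rw [purityGap_add_smul, hgap]
      rw [show -2 * Complex.normSq (w (0, 0) * w (1, 1) - w (0, 1) * w (1, 0)) = -c by
        rw [hcdef]; ring, ← Complex.ofReal_pow, ← Complex.ofReal_mul, Complex.add_re,
        Complex.add_re, Complex.re_ofReal_mul, Complex.ofReal_re, Complex.zero_re]
      exact hroot
    have hext := symmExtendible_of_purityGap_nonpos hpd h0 le_rfl
      (by simpa using hpd.posSemidef.det_nonneg)
    refine ⟨s⁻¹, by positivity, ?_⟩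
    have := hext.smul (inv_nonneg.2 hs.le)
    rwa [smul_add, smul_smul, ← Complex.ofReal_mul, inv_mul_cancel₀ hs.ne', Complex.ofReal_one,
      one_smul] at this

/-- Summing αₖρ + wₖwₖ* over the eigenvectors, weighted by the eigenvalues, gives a positive
multiple of ρ itself. -/
theorem symmExtendible_of_purityGap_pos {ρ : Matrix (Fin 2 × Fin 2) (Fin 2 × Fin 2) ℂ}
    (hρ : ρ.PosDef) (hq : 0 < (purityGap ρ).re) : SymmExtendible ρ := by
  set w : Fin 2 × Fin 2 → Fin 2 × Fin 2 → ℂ := fun k i =>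
    (hρ.isHermitian.eigenvectorUnitary : Matrix _ _ ℂ) i k
  set l : Fin 2 × Fin 2 → ℝ := hρ.isHermitian.eigenvalues
  have hl0 : ∀ k, 0 ≤ l k := fun k => (hρ.eigenvalues_pos k).le
  have hsum : ρ = ∑ k, (l k : ℂ) • Matrix.vecMulVec (w k) (star (w k)) :=
    isHermitian_eq_sum hρ.isHermitian
  choose α hα hext using fun k => exists_smul_add_pure hρ hq (w k)
  have h := SymmExtendible.sum Finset.univ fun k _ => (hext k).smul (hl0 k)
  have hr : 0 < (∑ k, l k * α k) + 1 := by
    have : 0 ≤ ∑ k, l k * α k := Finset.sum_nonneg fun k _ => mul_nonneg (hl0 k) (hα k)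
    linarith
  have e : ∑ k, (l k : ℂ) • ((α k : ℂ) • ρ + Matrix.vecMulVec (w k) (star (w k))) =
      (((∑ k, l k * α k) + 1 : ℝ) : ℂ) • ρ := by
    simp only [smul_add, Finset.sum_add_distrib, ← hsum, smul_smul, ← Finset.sum_smul]
    push_cast
    rw [add_smul, one_smul]
  rw [e] at h
  have := h.smul (inv_nonneg.2 hr.le)
  rwa [smul_smul, ← Complex.ofReal_mul, inv_mul_cancel₀ hr.ne', Complex.ofReal_one,
    one_smul] at this

theorem det_eq_ofReal_re {ρ : Matrix (Fin 2 × Fin 2) (Fin 2 × Fin 2) ℂ} (hρ : ρ.PosSemidef) :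
    ρ.det = (ρ.det.re : ℂ) ∧ 0 ≤ ρ.det.re :=
  ⟨Complex.eq_re_of_ofReal_le (r := 0) (by simpa using hρ.det_nonneg),
    (Complex.le_def.1 hρ.det_nonneg).1⟩

theorem symmExtendible_of_posDef {ρ : Matrix (Fin 2 × Fin 2) (Fin 2 × Fin 2) ℂ}
    (hρ : ρ.PosDef) (h : 0 ≤ (purityGap ρ).re + 4 * Real.sqrt ρ.det.re) : SymmExtendible ρ := by
  rcases lt_or_ge 0 (purityGap ρ).re with hq | hq
  · exact symmExtendible_of_purityGap_pos hρ hq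
  · obtain ⟨hd, hd0⟩ := det_eq_ofReal_re hρ.posSemidef
    refine symmExtendible_of_purityGap_nonpos hρ (q := -(purityGap ρ).re / 4) ?_ (by linarith) ?_
    · refine Complex.ext ?_ ?_
      · simp; ring
      · simpa using purityGap_im hρ.isHermitian
    · rw [hd, ← Complex.ofReal_pow, Complex.real_le_real]
      calc (-(purityGap ρ).re / 4) ^ 2 ≤ Real.sqrt ρ.det.re ^ 2 :=
            pow_le_pow_left₀ (by linarith) (by linarith) 2
        _ = ρ.det.re := Real.sq_sqrt hd0

/-! ### Compactness and singular states -/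

theorem norm_apply_le_trace {n : Type*} [Fintype n] [DecidableEq n] {τ : Matrix n n ℂ}
    (hτ : τ.PosSemidef) (i j : n) : ‖τ i j‖ ≤ τ.trace.re := by
  have hdiag : ∀ i, τ i i = ((τ i i).re : ℂ) ∧ 0 ≤ (τ i i).re := fun i =>
    ⟨Complex.eq_re_of_ofReal_le (r := 0) (by simpa using hτ.diag_nonneg (i := i)),
      (Complex.le_def.1 (hτ.diag_nonneg (i := i))).1⟩
  have hle : ∀ i, (τ i i).re ≤ τ.trace.re := fun i => by
    rw [Matrix.trace, Complex.re_sum]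
    exact Finset.single_le_sum (f := fun i => (τ i i).re) (fun k _ => (hdiag k).2)
      (Finset.mem_univ i)
  have hdet := (hτ.submatrix ![i, j]).det_nonneg
  rw [Matrix.det_fin_two] at hdet
  simp only [Matrix.submatrix_apply, Matrix.cons_val_zero, Matrix.cons_val_one] at hdet
  rw [← hτ.isHermitian.apply j i, ← starRingEnd_apply, Complex.mul_conj', (hdiag i).1,
    (hdiag j).1] at hdet
  have hreal : ‖τ i j‖ ^ 2 ≤ (τ i i).re * (τ j j).re := by
    exact_mod_cast sub_nonneg.1 hdet
  have h2 : ‖τ i j‖ ^ 2 ≤ τ.trace.re ^ 2 := by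
    refine hreal.trans ?_
    rw [pow_two]
    exact mul_le_mul (hle i) (hle j) (hdiag j).2 ((hdiag i).2.trans (hle i))
  exact (sq_le_sq₀ (norm_nonneg _) ((hdiag i).2.trans (hle i))).1 h2

theorem isClosed_posSemidef {n : Type*} [Fintype n] :
    IsClosed {τ : Matrix n n ℂ | τ.PosSemidef} := by
  have : {τ : Matrix n n ℂ | τ.PosSemidef} =
      {τ | τᴴ = τ} ∩ ⋂ x : n → ℂ, {τ | 0 ≤ star x ⬝ᵥ (τ *ᵥ x)} := by
    ext τ
    simp [Matrix.posSemidef_iff_dotProduct_mulVec, Matrix.IsHermitian]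
  rw [this]
  refine (isClosed_eq (by fun_prop) (by fun_prop)).inter (isClosed_iInter fun x => ?_)
  exact isClosed_le (by fun_prop) (by fun_prop)

theorem isCompact_posSemidef_trace_le (n : Type*) [Fintype n] [DecidableEq n] (r : ℝ) :
    IsCompact {τ : Matrix n n ℂ | τ.PosSemidef ∧ τ.trace.re ≤ r} := by
  have hK : IsCompact (Set.pi Set.univ fun _ : n => Set.pi Set.univ fun _ : n =>
      Metric.closedBall (0 : ℂ) r) :=
    isCompact_univ_pi fun _ => isCompact_univ_pi fun _ => isCompact_closedBall _ _
  refine IsCompact.of_isClosed_subset (X := Matrix n n ℂ) hK ?_ ?_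
  · exact isClosed_posSemidef.inter (isClosed_le
      (by fun_prop : Continuous fun τ : Matrix n n ℂ => τ.trace.re) continuous_const)
  · rintro τ ⟨hτ, hr⟩ i - j -
    simpa using (norm_apply_le_trace hτ i j).trans hr

theorem continuous_marginalAB {A B : Type*} [Fintype B] :
    Continuous (marginalAB : Matrix (A × B × B) (A × B × B) ℂ → Matrix (A × B) (A × B) ℂ) := by
  refine continuous_pi fun i => continuous_pi fun j => ?_
  exact continuous_finsetSum _ fun c _ => by fun_prop

theorem continuous_marginalAB' {A B : Type*} [Fintype B] :
    Continuous (marginalAB' : Matrix (A × B × B) (A × B × B) ℂ → Matrix (A × B) (A × B) ℂ) := by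
  refine continuous_pi fun i => continuous_pi fun j => ?_
  exact continuous_finsetSum _ fun c _ => by fun_prop

open Filter Topology in
-- Eventually the extensions have bounded trace, so they lie in a compact set whose image under the
-- two marginals is closed.
theorem symmExtendible_of_tendsto {A B : Type*} [Fintype A] [Fintype B]
    {ρ : ℕ → Matrix (A × B) (A × B) ℂ} {σ : Matrix (A × B) (A × B) ℂ}
    (hρ : ∀ n, SymmExtendible (ρ n)) (hlim : Tendsto ρ atTop (𝓝 σ)) : SymmExtendible σ := by
  classical
  have htr : Tendsto (fun n => (ρ n).trace.re) atTop (𝓝 σ.trace.re) :=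
    (Continuous.tendsto (by fun_prop : Continuous fun M : Matrix (A × B) (A × B) ℂ =>
      M.trace.re) σ).comp hlim
  have hK := isCompact_posSemidef_trace_le (A × B × B) (σ.trace.re + 1)
  have hcont : Continuous fun τ : Matrix (A × B × B) (A × B × B) ℂ =>
      (marginalAB τ, marginalAB' τ) := continuous_marginalAB.prodMk continuous_marginalAB'
  have hmem := (hK.image hcont).isClosed.mem_of_tendsto (hlim.prodMk_nhds hlim) <| by
    filter_upwards [htr.eventually (gt_mem_nhds (lt_add_one _))] with n hn
    obtain ⟨τ, hτ, h1, h2⟩ := hρ n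
    exact ⟨τ, ⟨hτ, by rw [← trace_marginalAB, h1]; exact hn.le⟩, Prod.ext h1 h2⟩
  obtain ⟨τ, ⟨hτ, -⟩, h⟩ := hmem
  exact ⟨τ, hτ, congrArg Prod.fst h, congrArg Prod.snd h⟩

theorem trace_reduction (ρ : Matrix (Fin 2 × Fin 2) (Fin 2 × Fin 2) ℂ) :
    (reduction ρ).trace = ρ.trace := by
  simp [reduction, Matrix.trace, Fintype.sum_prod_type, marginalB]
  ring

theorem purityGap_add_smul_one (ρ : Matrix (Fin 2 × Fin 2) (Fin 2 × Fin 2) ℂ) (t : ℝ) :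
    (purityGap (ρ + (t : ℂ) • 1)).re =
      (purityGap ρ).re + t * (2 * ρ.trace.re) + t ^ 2 * 4 := by
  have h1 : reduction (1 : Matrix (Fin 2 × Fin 2) (Fin 2 × Fin 2) ℂ) = 1 := by
    ext ⟨a, b⟩ ⟨a', b'⟩
    fin_cases a <;> fin_cases b <;> fin_cases a' <;> fin_cases b' <;>
      simp [reduction, marginalB] <;> norm_num
  have h2 : purityGap 1 = 4 := by
    simp [purityGap, h1]
  rw [purityGap_add_smul, h1, h2, Matrix.mul_one, Matrix.one_mul, trace_reduction,
    Complex.add_re, Complex.add_re, Complex.re_ofReal_mul, ← Complex.ofReal_pow,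
    Complex.re_ofReal_mul, Complex.add_re, Complex.re_ofNat]
  ring

theorem posDef_add_smul_one {ρ : Matrix (Fin 2 × Fin 2) (Fin 2 × Fin 2) ℂ} (hρ : ρ.PosSemidef)
    {t : ℝ} (ht : 0 < t) : (ρ + (t : ℂ) • 1).PosDef :=
  (Matrix.PosDef.one.smul (by exact_mod_cast ht)).posSemidef_add hρ

theorem symmExtendible_of_purityGap {ρ : Matrix (Fin 2 × Fin 2) (Fin 2 × Fin 2) ℂ}
    (hρ : ρ.PosSemidef) (h : 0 ≤ (purityGap ρ).re + 4 * Real.sqrt ρ.det.re) :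
    SymmExtendible ρ := by
  by_cases hd : ρ.det = 0
  · have htr : 0 ≤ ρ.trace.re := (Complex.le_def.1 hρ.trace_nonneg).1
    have hgap : 0 ≤ (purityGap ρ).re := by simpa [hd] using h
    -- Adding t1 with t > 0 raises the gap by 2t tr ρ + 4t² > 0, which reduces to the positive
    -- definite case.
    refine symmExtendible_of_tendsto (ρ := fun n : ℕ => ρ + ((1 / ((n : ℝ) + 1) : ℝ) : ℂ) • 1)
      (fun n => ?_) ?_
    · have ht : 0 < 1 / ((n : ℝ) + 1) := by positivity
      refine symmExtendible_of_purityGap_pos (posDef_add_smul_one hρ ht) ?_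
      rw [purityGap_add_smul_one]
      positivity
    · have h0 := tendsto_one_div_add_atTop_nhds_zero_nat (𝕜 := ℝ)
      have hc : Continuous fun t : ℝ =>
          ρ + (t : ℂ) • (1 : Matrix (Fin 2 × Fin 2) (Fin 2 × Fin 2) ℂ) := by fun_prop
      simpa only [Function.comp_def, Complex.ofReal_zero, zero_smul, add_zero] using
        (hc.tendsto 0).comp h0
  · exact symmExtendible_of_posDef (hρ.posDef_iff_det_ne_zero.2 hd) h

/-! ### Necessity: the witness inequality -/

/-- The expectation of `H ⊗ 1_{B'}` in the (unnormalised) vector `ψ`. -/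
noncomputable def expectation (H : Matrix (Fin 2 × Fin 2) (Fin 2 × Fin 2) ℂ)
    (ψ : Fin 2 × Fin 2 × Fin 2 → ℂ) : ℂ :=
  ∑ c, star (fun i : Fin 2 × Fin 2 => ψ (i.1, i.2, c)) ⬝ᵥ (H *ᵥ fun i => ψ (i.1, i.2, c))

theorem star_star_dotProduct {n : Type*} [Fintype n] (x y : n → ℂ) :
    star (star x ⬝ᵥ y) = star y ⬝ᵥ x := by
  rw [Matrix.star_dotProduct, star_star, dotProduct_comm]

theorem quadratic_form_eq_sum {n : Type*} [Fintype n] [DecidableEq n] {M : Matrix n n ℂ}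
    (hM : M.IsHermitian) (x : n → ℂ) :
    star x ⬝ᵥ (M *ᵥ x) = ((∑ k, hM.eigenvalues k *
      Complex.normSq (star (fun i => (hM.eigenvectorUnitary : Matrix n n ℂ) i k) ⬝ᵥ x) : ℝ) : ℂ) := by
  conv_lhs => rw [isHermitian_eq_sum hM, Matrix.sum_mulVec, dotProduct_sum]
  push_cast
  refine Finset.sum_congr rfl fun k _ => ?_
  rw [Matrix.smul_mulVec, dotProduct_smul, Matrix.vecMulVec_mulVec, ← Complex.mul_conj,
    smul_eq_mul]
  congr 1
  generalize (fun i => (hM.eigenvectorUnitary : Matrix n n ℂ) i k) = u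
  rw [starRingEnd_apply, star_star_dotProduct]
  simp [mul_comm]

theorem eigenvector_orthonormal {n : Type*} [Fintype n] [DecidableEq n] {M : Matrix n n ℂ}
    (hM : M.IsHermitian) (k l : n) :
    star (fun i => (hM.eigenvectorUnitary : Matrix n n ℂ) i k) ⬝ᵥ
      (fun i => (hM.eigenvectorUnitary : Matrix n n ℂ) i l) = if k = l then 1 else 0 := by
  have h := congrFun (congrFun (Unitary.coe_star_mul_self hM.eigenvectorUnitary) k) l
  rw [Matrix.one_apply, Matrix.mul_apply] at h
  exact h

theorem mulVec_eigenvector {n : Type*} [Fintype n] [DecidableEq n] {M : Matrix n n ℂ}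
    (hM : M.IsHermitian) (k : n) :
    M *ᵥ (fun i => (hM.eigenvectorUnitary : Matrix n n ℂ) i k) =
      (hM.eigenvalues k : ℂ) • (fun i => (hM.eigenvectorUnitary : Matrix n n ℂ) i k) :=
  hM.mulVec_eigenvectorBasis k

/-- Positivity on product vectors of a Hermitian operator (block positivity). -/
def BlockPositive (H : Matrix (Fin 2 × Fin 2) (Fin 2 × Fin 2) ℂ) : Prop :=
  ∀ v w : Fin 2 → ℂ, v ≠ 0 → w ≠ 0 →
    0 < star (fun i : Fin 2 × Fin 2 => v i.1 * w i.2) ⬝ᵥ (H *ᵥ fun i => v i.1 * w i.2)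

theorem BlockPositive.det_ne_zero {H : Matrix (Fin 2 × Fin 2) (Fin 2 × Fin 2) ℂ}
    (hpos : BlockPositive H) {x : Fin 2 × Fin 2 → ℂ} (hx : x ≠ 0)
    (hneg : (star x ⬝ᵥ (H *ᵥ x)).re ≤ 0) :
    x (0, 0) * x (1, 1) - x (0, 1) * x (1, 0) ≠ 0 := by
  intro h
  obtain ⟨v, w, rfl⟩ := exists_product_of_det_eq_zero (sub_eq_zero.1 h)
  have hv : v ≠ 0 := by rintro rfl; exact hx (by ext; simp)
  have hw : w ≠ 0 := by rintro rfl; exact hx (by ext; simp)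
  have := (Complex.lt_def.1 (hpos v w hv hw)).1
  simp only [Complex.zero_re] at this
  linarith

/-- Two negative eigenvalues would make H negative on a plane, and every plane in ℂ² ⊗ ℂ² contains a
nonzero product vector. -/
theorem BlockPositive.eigenvalues_nonneg {H : Matrix (Fin 2 × Fin 2) (Fin 2 × Fin 2) ℂ}
    (hpos : BlockPositive H) (hH : H.IsHermitian) {k l : Fin 2 × Fin 2} (hkl : k ≠ l)
    (hk : hH.eigenvalues k < 0) : 0 ≤ hH.eigenvalues l := by
  by_contra! hl
  set u : Fin 2 × Fin 2 → Fin 2 × Fin 2 → ℂ := fun k i =>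
    (hH.eigenvectorUnitary : Matrix _ _ ℂ) i k
  have horth : ∀ k l, star (u k) ⬝ᵥ u l = if k = l then 1 else 0 := eigenvector_orthonormal hH
  have hform : ∀ x, star x ⬝ᵥ (H *ᵥ x) =
      ((∑ k, hH.eigenvalues k * Complex.normSq (star (u k) ⬝ᵥ x) : ℝ) : ℂ) :=
    quadratic_form_eq_sum hH
  have hne : ∀ z : ℂ, u k + z • u l ≠ 0 := by
    intro z h
    have := congrArg (star (u k) ⬝ᵥ ·) h
    simp [horth, hkl] at this
  have hneg : ∀ z : ℂ, (star (u k + z • u l) ⬝ᵥ (H *ᵥ (u k + z • u l))).re ≤ 0 := by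
    intro z
    rw [hform, Complex.ofReal_re]
    refine Finset.sum_nonpos fun m _ => ?_
    rw [dotProduct_add, dotProduct_smul, horth, horth]
    by_cases hmk : m = k
    · subst hmk
      exact mul_nonpos_of_nonpos_of_nonneg hk.le (Complex.normSq_nonneg _)
    by_cases hml : m = l
    · subst hml
      exact mul_nonpos_of_nonpos_of_nonneg hl.le (Complex.normSq_nonneg _)
    · simp [hmk, hml]
  have hul : u l ≠ 0 := fun h => by simpa [h] using horth l l
  have hdl : u l (0, 0) * u l (1, 1) - u l (0, 1) * u l (1, 0) ≠ 0 := by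
    refine hpos.det_ne_zero hul ?_
    rw [hform, Complex.ofReal_re]
    refine Finset.sum_nonpos fun m _ => ?_
    rw [horth]
    by_cases hml : m = l
    · subst hml
      exact mul_nonpos_of_nonpos_of_nonneg hl.le (Complex.normSq_nonneg _)
    · simp [hml]
  -- The determinant of u k + z • u l is quadratic in z, with nonzero leading coefficient; a root
  -- yields a product vector.
  obtain ⟨z, hz⟩ := exists_quadratic_eq_zero hdl
    (b := u k (0, 0) * u l (1, 1) + u l (0, 0) * u k (1, 1) - u k (0, 1) * u l (1, 0) -
      u l (0, 1) * u k (1, 0))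
    (c := u k (0, 0) * u k (1, 1) - u k (0, 1) * u k (1, 0)) (IsAlgClosed.exists_eq_mul_self _)
  refine hpos.det_ne_zero (hne z) (hneg z) ?_
  simp only [Pi.add_apply, Pi.smul_apply, smul_eq_mul]
  linear_combination hz

/-- A Hermitian, block positive `H` whose inverse has vanishing partial trace over `B` is
nonnegative, after tensoring with `1_{B'}`, on vectors symmetric under `B ↔ B'`. -/
theorem expectation_nonneg_of_symm {H E : Matrix (Fin 2 × Fin 2) (Fin 2 × Fin 2) ℂ}
    (hpos : BlockPositive H) (hH : H.IsHermitian) (hHE : H * E = 1)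
    (htr : ∀ a a', E (a, 0) (a', 0) + E (a, 1) (a', 1) = 0)
    {ψ : Fin 2 × Fin 2 × Fin 2 → ℂ} (hψ : ∀ a b c, ψ (a, b, c) = ψ (a, c, b)) :
    0 ≤ (expectation H ψ).re := by
  set u : Fin 2 × Fin 2 → Fin 2 × Fin 2 → ℂ := fun k i =>
    (hH.eigenvectorUnitary : Matrix _ _ ℂ) i k
  have horth : ∀ k l, star (u k) ⬝ᵥ u l = if k = l then 1 else 0 := eigenvector_orthonormal hH
  have hform : ∀ x, star x ⬝ᵥ (H *ᵥ x) =
      ((∑ k, hH.eigenvalues k * Complex.normSq (star (u k) ⬝ᵥ x) : ℝ) : ℂ) :=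
    quadratic_form_eq_sum hH
  by_cases hall : ∀ k, 0 ≤ hH.eigenvalues k
  · rw [expectation, Complex.re_sum]
    refine Finset.sum_nonneg fun c _ => ?_
    rw [hform, Complex.ofReal_re]
    exact Finset.sum_nonneg fun k _ => mul_nonneg (hall k) (Complex.normSq_nonneg _)
  push Not at hall
  obtain ⟨k, hk⟩ := hall
  have hdet : u k (0, 0) * u k (1, 1) - u k (0, 1) * u k (1, 0) ≠ 0 := by
    refine hpos.det_ne_zero (fun h => by simpa [h] using horth k k) ?_
    rw [hform, Complex.ofReal_re]
    refine Finset.sum_nonpos fun m _ => ?_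
    rw [horth]
    by_cases hmk : m = k
    · subst hmk
      exact mul_nonpos_of_nonpos_of_nonneg hk.le (Complex.normSq_nonneg _)
    · simp [hmk]
  set x : Fin 2 → Fin 2 × Fin 2 → ℂ := fun c i => ψ (i.1, i.2, c)
  set D := star (u k (0, 0)) * star (u k (1, 1)) - star (u k (0, 1)) * star (u k (1, 0)) with hD
  have hD0 : D ≠ 0 := by
    have := star_ne_zero.2 hdet
    rwa [star_sub, star_mul', star_mul'] at this
  -- The slices x b will be shifted by E g b, where g is c tensored with a singlet. Cramer's rule
  -- chooses c to make the shifted slices orthogonal to the negative eigenvector; it applies because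
  -- that eigenvector is entangled, so D ≠ 0.
  set t : Fin 2 → ℂ := fun b => (hH.eigenvalues k : ℂ) * (star (u k) ⬝ᵥ x b)
  set c : Fin 2 → ℂ := ![(- t 1 * star (u k (1, 1)) - t 0 * star (u k (1, 0))) / D,
    (star (u k (0, 0)) * t 0 + star (u k (0, 1)) * t 1) / D]
  set g : Fin 2 → Fin 2 × Fin 2 → ℂ := fun b i => c i.1 * (!![0, 1; -1, 0] : Matrix _ _ ℂ) i.2 b
  have hug : ∀ b, star (u k) ⬝ᵥ g b = - t b := by
    intro b
    fin_cases b <;> simp [dotProduct, Fintype.sum_prod_type, g, c] <;> field_simp <;>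
      rw [hD] <;> simp <;> ring
  have huE : ∀ y, (hH.eigenvalues k : ℂ) * (star (u k) ⬝ᵥ (E *ᵥ y)) = star (u k) ⬝ᵥ y := by
    intro y
    have h1 : star (u k) ᵥ* H = (hH.eigenvalues k : ℂ) • star (u k) := by
      have := congrArg star (mulVec_eigenvector hH k)
      rw [Matrix.star_mulVec, hH] at this
      rw [this, star_smul]
      simp [u]
    calc _ = (star (u k) ᵥ* H) ⬝ᵥ (E *ᵥ y) := by rw [h1, smul_dotProduct, smul_eq_mul]
      _ = _ := by rw [← Matrix.dotProduct_mulVec, Matrix.mulVec_mulVec, hHE, Matrix.one_mulVec]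
  have hk0 : (hH.eigenvalues k : ℂ) ≠ 0 := by exact_mod_cast hk.ne
  have hzero : ∀ b, star (u k) ⬝ᵥ (x b + E *ᵥ g b) = 0 := by
    intro b
    apply (mul_eq_zero.1 _).resolve_left hk0
    rw [dotProduct_add, mul_add, huE, hug]
    simp [t]
  -- The shift costs nothing: x is symmetric and g antisymmetric in BB', so their pairing vanishes,
  -- and ⟨g, Eg⟩ vanishes because tr_B E = 0.
  have hshift : expectation H ψ = ∑ b, star (x b + E *ᵥ g b) ⬝ᵥ (H *ᵥ (x b + E *ᵥ g b)) := by
    have h1 : ∀ b, star (x b + E *ᵥ g b) ⬝ᵥ (H *ᵥ (x b + E *ᵥ g b)) =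
        star (x b) ⬝ᵥ (H *ᵥ x b) + star (x b) ⬝ᵥ g b + star (star (x b) ⬝ᵥ g b) +
          star (star (g b) ⬝ᵥ (E *ᵥ g b)) := by
      intro b
      have e1 : H *ᵥ (E *ᵥ g b) = g b := by rw [Matrix.mulVec_mulVec, hHE, Matrix.one_mulVec]
      have e2 : star (E *ᵥ g b) ⬝ᵥ (H *ᵥ x b) = star (g b) ⬝ᵥ x b := by
        rw [Matrix.dotProduct_mulVec, ← hH.eq, ← Matrix.star_mulVec, e1]
      rw [Matrix.mulVec_add, star_add, dotProduct_add, add_dotProduct, add_dotProduct, e1, e2,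
        star_star_dotProduct, star_star_dotProduct]
      ring
    have h2 : ∑ b, star (x b) ⬝ᵥ g b = 0 := by
      simp [dotProduct, Fintype.sum_prod_type, x, g]
      rw [hψ 0 1 0, hψ 1 1 0]
      ring
    have h3 : ∑ b, star (g b) ⬝ᵥ (E *ᵥ g b) = 0 := by
      simp [dotProduct, Matrix.mulVec, Fintype.sum_prod_type, g]
      linear_combination starRingEnd ℂ (c 0) * c 0 * htr 0 0 + starRingEnd ℂ (c 0) * c 1 * htr 0 1 +
        starRingEnd ℂ (c 1) * c 0 * htr 1 0 + starRingEnd ℂ (c 1) * c 1 * htr 1 1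
    simp only [h1, Finset.sum_add_distrib, ← star_sum, h2, h3]
    simp [expectation, x]
  rw [hshift, Complex.re_sum]
  refine Finset.sum_nonneg fun b _ => ?_
  rw [hform, Complex.ofReal_re]
  refine Finset.sum_nonneg fun m _ => ?_
  by_cases hmk : m = k
  · subst hmk
    rw [hzero]
    simp
  · exact mul_nonneg (hpos.eigenvalues_nonneg hH (Ne.symm hmk) hk) (Complex.normSq_nonneg _)

theorem BlockPositive.product_nonneg {H : Matrix (Fin 2 × Fin 2) (Fin 2 × Fin 2) ℂ}
    (hpos : BlockPositive H) (v w : Fin 2 → ℂ) :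
    0 ≤ star (fun i : Fin 2 × Fin 2 => v i.1 * w i.2) ⬝ᵥ (H *ᵥ fun i => v i.1 * w i.2) := by
  rcases eq_or_ne v 0 with rfl | hv
  · simp [dotProduct]
  rcases eq_or_ne w 0 with rfl | hw
  · simp [dotProduct]
  exact (hpos v w hv hw).le

/-- Each slice of an antisymmetric vector at fixed B' is a product vector. -/
theorem expectation_nonneg_of_antisymm {H : Matrix (Fin 2 × Fin 2) (Fin 2 × Fin 2) ℂ}
    (hpos : BlockPositive H) {ψ : Fin 2 × Fin 2 × Fin 2 → ℂ}
    (hψ : ∀ a b c, ψ (a, b, c) = -ψ (a, c, b)) : 0 ≤ (expectation H ψ).re := by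
  have hdiag : ∀ a b, ψ (a, b, b) = 0 := fun a b => self_eq_neg.1 (hψ a b b)
  have h0 : (fun i : Fin 2 × Fin 2 => ψ (i.1, i.2, 0)) =
      fun i => (fun a => ψ (a, 1, 0)) i.1 * (![0, 1] : Fin 2 → ℂ) i.2 := by
    ext ⟨a, b⟩
    fin_cases b <;> simp [hdiag]
  have h1 : (fun i : Fin 2 × Fin 2 => ψ (i.1, i.2, 1)) =
      fun i => (fun a => ψ (a, 0, 1)) i.1 * (![1, 0] : Fin 2 → ℂ) i.2 := by
    ext ⟨a, b⟩
    fin_cases b <;> simp [hdiag]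
  rw [expectation, Fin.sum_univ_two, h0, h1]
  have h := (Complex.le_def.1 (add_nonneg
    (hpos.product_nonneg (fun a => ψ (a, 1, 0)) ![0, 1])
    (hpos.product_nonneg (fun a => ψ (a, 0, 1)) ![1, 0]))).1
  rwa [Complex.zero_re] at h

/-- By the parallelogram law, twice this sum is the expectation in the symmetric part plus that in
the antisymmetric part. -/
theorem expectation_add_swap_nonneg {H E : Matrix (Fin 2 × Fin 2) (Fin 2 × Fin 2) ℂ}
    (hpos : BlockPositive H) (hH : H.IsHermitian) (hHE : H * E = 1)
    (htr : ∀ a a', E (a, 0) (a', 0) + E (a, 1) (a', 1) = 0)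
    (ψ : Fin 2 × Fin 2 × Fin 2 → ℂ) :
    0 ≤ (expectation H ψ + expectation H fun i => ψ (i.1, i.2.2, i.2.1)).re := by
  have hs := expectation_nonneg_of_symm hpos hH hHE htr
    (ψ := fun i => ψ (i.1, i.2.1, i.2.2) + ψ (i.1, i.2.2, i.2.1)) fun a b c => add_comm _ _
  have ha := expectation_nonneg_of_antisymm hpos
    (ψ := fun i => ψ (i.1, i.2.1, i.2.2) - ψ (i.1, i.2.2, i.2.1))
    fun a b c => (neg_sub _ _).symm
  have key : (expectation H fun i => ψ (i.1, i.2.1, i.2.2) + ψ (i.1, i.2.2, i.2.1)) +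
      (expectation H fun i => ψ (i.1, i.2.1, i.2.2) - ψ (i.1, i.2.2, i.2.1)) =
      (2 : ℝ) * (expectation H ψ + expectation H fun i => ψ (i.1, i.2.2, i.2.1)) := by
    simp only [expectation, ← Finset.sum_add_distrib, Finset.mul_sum]
    refine Finset.sum_congr rfl fun c _ => ?_
    set x : Fin 2 × Fin 2 → ℂ := fun i => ψ (i.1, i.2, c)
    set y : Fin 2 × Fin 2 → ℂ := fun i => ψ (i.1, c, i.2)
    change star (x + y) ⬝ᵥ (H *ᵥ (x + y)) + star (x - y) ⬝ᵥ (H *ᵥ (x - y)) = _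
    simp only [star_add, star_sub, Matrix.mulVec_add, Matrix.mulVec_sub, add_dotProduct,
      sub_dotProduct, dotProduct_add, dotProduct_sub]
    push_cast
    ring
  have := congrArg Complex.re key
  rw [Complex.add_re, Complex.re_ofReal_mul] at this
  linarith

theorem trace_mul_marginal_vecMulVec (H : Matrix (Fin 2 × Fin 2) (Fin 2 × Fin 2) ℂ)
    (ψ : Fin 2 × Fin 2 × Fin 2 → ℂ) :
    (H * marginalAB (Matrix.vecMulVec ψ (star ψ))).trace = expectation H ψ ∧
    (H * marginalAB' (Matrix.vecMulVec ψ (star ψ))).trace =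
      expectation H fun i => ψ (i.1, i.2.2, i.2.1) := by
  constructor <;>
  simp [Matrix.trace, Matrix.mul_apply, marginalAB, marginalAB', expectation, Matrix.vecMulVec_apply,
    dotProduct, Matrix.mulVec, Fintype.sum_prod_type] <;> ring

theorem marginal_sum_smul {A B ι : Type*} [Fintype B] [Fintype ι] (l : ι → ℂ)
    (τ : ι → Matrix (A × B × B) (A × B × B) ℂ) :
    marginalAB (∑ k, l k • τ k) = ∑ k, l k • marginalAB (τ k) ∧
    marginalAB' (∑ k, l k • τ k) = ∑ k, l k • marginalAB' (τ k) := by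
  constructor <;> ext i j <;>
  simp only [marginalAB, marginalAB', Matrix.sum_apply, Matrix.smul_apply, Finset.smul_sum] <;>
  exact Finset.sum_comm

/-- The witness inequality: `tr (H ρ) ≥ 0` for every `ρ` with a symmetric extension. -/
theorem SymmExtendible.trace_mul_nonneg {ρ : Matrix (Fin 2 × Fin 2) (Fin 2 × Fin 2) ℂ}
    (hρ : SymmExtendible ρ) {H E : Matrix (Fin 2 × Fin 2) (Fin 2 × Fin 2) ℂ}
    (hpos : BlockPositive H) (hH : H.IsHermitian) (hHE : H * E = 1)
    (htr : ∀ a a', E (a, 0) (a', 0) + E (a, 1) (a', 1) = 0) : 0 ≤ (H * ρ).trace.re := by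
  obtain ⟨τ, hτ, h1, h2⟩ := hρ
  obtain ⟨l, u, hl, hsum⟩ : ∃ (l : Fin 2 × Fin 2 × Fin 2 → ℝ)
      (u : Fin 2 × Fin 2 × Fin 2 → Fin 2 × Fin 2 × Fin 2 → ℂ), (∀ k, 0 ≤ l k) ∧
      τ = ∑ k, (l k : ℂ) • Matrix.vecMulVec (u k) (star (u k)) :=
    ⟨_, _, hτ.eigenvalues_nonneg, isHermitian_eq_sum hτ.isHermitian⟩
  have hAB : (H * ρ).trace + (H * ρ).trace = ∑ k, (l k : ℂ) *
      (expectation H (u k) + expectation H fun i => u k (i.1, i.2.2, i.2.1)) := by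
    nth_rw 1 [← h1]
    rw [← h2, hsum, (marginal_sum_smul _ _).1, (marginal_sum_smul _ _).2]
    simp only [Matrix.mul_sum, Matrix.trace_sum, Matrix.mul_smul, Matrix.trace_smul,
      (trace_mul_marginal_vecMulVec H _).1, (trace_mul_marginal_vecMulVec H _).2,
      ← Finset.sum_add_distrib, smul_eq_mul, mul_add]
  have h := congrArg Complex.re hAB
  rw [Complex.add_re, Complex.re_sum] at h
  have : 0 ≤ ∑ k, ((l k : ℂ) *
      (expectation H (u k) + expectation H fun i => u k (i.1, i.2.2, i.2.1))).re := by
    refine Finset.sum_nonneg fun k _ => ?_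
    rw [Complex.re_ofReal_mul]
    exact mul_nonneg (hl k) (expectation_add_swap_nonneg hpos hH hHE htr _)
  linarith

/-- At a positive definite `σ` with `tr σ_B² - tr σ² = -4 √det σ`, the witness is nonnegative on
every operator with a symmetric extension. -/
theorem SymmExtendible.trace_mul_witness_nonneg {ρ σ : Matrix (Fin 2 × Fin 2) (Fin 2 × Fin 2) ℂ}
    (hρ : SymmExtendible ρ) (hσ : σ.PosDef) {q : ℝ} (hq : purityGap σ = -4 * q) (hq0 : 0 ≤ q)
    (hd : σ.det = (q : ℂ) ^ 2) : 0 ≤ (witness σ q * ρ).trace.re := by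
  have hC := reductionCore_posDef hσ hq hq0 hd.ge
  have hid := witness_identity hσ hq
  rw [hd, sub_self, zero_smul, add_zero] at hid
  have htr := sum_mul_witness hσ hq
  -- Since HσH = C ⊗ 1, the inverse of H is σH(C⁻¹ ⊗ 1), whose partial trace over B is tr_B(σH)C⁻¹ =
  -- 0.
  refine hρ.trace_mul_nonneg (E := σ * witness σ q * ((reductionCore σ)⁻¹ ⊗ₖ 1))
    (fun v w hv hw => witness_product_pos hσ hq0 hv hw) (witness_isHermitian hσ.isHermitian q) ?_ ?_
  · rw [← Matrix.mul_assoc, ← Matrix.mul_assoc, hid, kronecker_one_mul_inv hC.isUnit]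
  · intro a a'
    generalize σ * witness σ q = G at htr
    simp only [Matrix.mul_apply, Fintype.sum_prod_type, Fin.sum_univ_two,
      Matrix.kroneckerMap_apply, Matrix.one_apply]
    simp
    linear_combination (reductionCore σ)⁻¹ 0 a' * htr a 0 + (reductionCore σ)⁻¹ 1 a' * htr a 1

/-! ### Necessity: reaching the boundary -/

theorem SymmExtendible.purityGap {ρ : Matrix (Fin 2 × Fin 2) (Fin 2 × Fin 2) ℂ}
    (hρ : ρ.PosSemidef) (hext : SymmExtendible ρ) :
    0 ≤ (purityGap ρ).re + 4 * Real.sqrt ρ.det.re := by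
  by_contra! hneg
  have htr : 0 ≤ ρ.trace.re := (Complex.le_def.1 hρ.trace_nonneg).1
  set f : ℝ → ℝ := fun t => (QuantumState.purityGap (ρ + (t : ℂ) • 1)).re +
    4 * Real.sqrt (ρ + (t : ℂ) • 1).det.re with hf
  have hcont : Continuous f := by
    have hdet : Continuous fun t : ℝ =>
        (ρ + (t : ℂ) • (1 : Matrix (Fin 2 × Fin 2) (Fin 2 × Fin 2) ℂ)).det :=
      Continuous.matrix_det (by fun_prop)
    simp only [hf, purityGap_add_smul_one]
    fun_prop
  -- S² ≥ S ≥ |Q|, so the term 4S² outweighs a negative gap.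
  set S : ℝ := 1 + |(QuantumState.purityGap ρ).re| with hS
  have hS1 : 1 ≤ S := by simp [hS]
  have hfS : 0 ≤ f S := by
    have h1 : 0 ≤ (QuantumState.purityGap (ρ + (S : ℂ) • 1)).re := by
      rw [purityGap_add_smul_one]
      have := neg_abs_le (QuantumState.purityGap ρ).re
      nlinarith [mul_nonneg (zero_le_one.trans hS1) htr]
    exact add_nonneg h1 (by positivity)
  have hf0 : f 0 < 0 := by simpa [hf] using hneg
  obtain ⟨t, ht, hft⟩ := intermediate_value_Icc (by linarith : (0 : ℝ) ≤ S) hcont.continuousOn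
    ⟨hf0.le, hfS⟩
  have ht0 : 0 < t := lt_of_le_of_ne ht.1 (by rintro rfl; exact hf0.ne hft)
  have hσ := posDef_add_smul_one hρ ht0
  simp only [hf] at hft
  set σ := ρ + (t : ℂ) • (1 : Matrix (Fin 2 × Fin 2) (Fin 2 × Fin 2) ℂ) with hσdef
  obtain ⟨hd, hd0⟩ := det_eq_ofReal_re hσ.posSemidef
  set q := Real.sqrt σ.det.re with hqdef
  have hq : QuantumState.purityGap σ = -4 * q := by
    refine Complex.ext ?_ ?_
    · simp only [Complex.mul_re, Complex.neg_re, Complex.re_ofNat, Complex.ofReal_re,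
        Complex.ofReal_im, mul_zero, sub_zero]
      linarith
    · simpa using purityGap_im hσ.isHermitian
  have hdq : σ.det = (q : ℂ) ^ 2 := by
    rw [hd, ← Complex.ofReal_pow, hqdef, Real.sq_sqrt hd0]
  have hnonneg := hext.trace_mul_witness_nonneg hσ hq (Real.sqrt_nonneg _) hdq
  have hzero : (witness σ q * σ).trace = 0 := by
    rw [Matrix.trace_mul_comm, Matrix.trace, Fintype.sum_prod_type, Fin.sum_univ_two,
      Fin.sum_univ_two, Fin.sum_univ_two]
    simp only [Matrix.diag_apply]
    linear_combination sum_mul_witness hσ hq 0 0 + sum_mul_witness hσ hq 1 1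
  have hpos : 0 < (witness σ q).trace := by
    rw [witness, Matrix.trace_add, trace_reduction, Matrix.trace_smul]
    exact add_pos_of_pos_of_nonneg hσ.trace_pos
      (smul_nonneg (by exact_mod_cast Real.sqrt_nonneg _) hσ.inv.posSemidef.trace_nonneg)
  have hposre := (Complex.lt_def.1 hpos).1
  -- Expanding σ gives tr(Hρ) + t tr H = 0, impossible with tr(Hρ) ≥ 0, t > 0 and tr H > 0.
  rw [hσdef, Matrix.mul_add, Matrix.mul_smul, Matrix.mul_one, Matrix.trace_add, Matrix.trace_smul,
    ← hσdef] at hzero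
  have := congrArg Complex.re hzero
  rw [Complex.add_re, smul_eq_mul, Complex.re_ofReal_mul, Complex.zero_re] at this
  have := mul_pos ht0 hposre
  simp only [Complex.zero_re] at *
  linarith

end QuantumState

/-- For a two-qubit state the traces and the determinant below are real (the determinant is
nonnegative), so taking real parts loses nothing. -/
theorem theorem1 (ρ : Matrix (Fin 2 × Fin 2) (Fin 2 × Fin 2) ℂ)
    (hρ : QuantumState.IsState ρ) :
    QuantumState.HasSymmetricExtension ρ ↔
      ((QuantumState.marginalB ρ ^ 2).trace).re ≥
        ((ρ ^ 2).trace).re - 4 * Real.sqrt (ρ.det).re := by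
  have hgap := congrArg Complex.re (QuantumState.purityGap_eq ρ)
  rw [Complex.sub_re] at hgap
  constructor
  · rintro ⟨τ, hτ, h1, h2⟩
    have := QuantumState.SymmExtendible.purityGap hρ.1 ⟨τ, hτ.1, h1, h2⟩
    linarith
  · intro h
    exact (QuantumState.symmExtendible_of_purityGap hρ.1 (by linarith)).hasSymmetricExtension hρ.2
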